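/- For $\mu\ge 0$ put $$H(\mu)=\mu\sum_{n=1}^{\infty}\frac{(n+1)^2}{(n(n+2)+\mu^2)^2},\qquad F(\mu)=\mu\sum_{m\in\mathbb{Z}^3\setminus\{0\}}\frac{1}{(|m|^2+\mu^2)^2},$$ where $|m|$ is the Euclidean length of $m$; both series converge for every $\mu\ge 0$. The function $H$ attains a global maximum on $[0,\infty)$, and the number $\delta_{\mathbb{S}^3}$ defined by $\max_{\mu\ge 0}H(\mu)=\delta_{\mathbb{S}^3}\cdot\frac{\pi}{4}$ satisfies $1.0139\le\delta_{\mathbb{S}^3}<1.0140$ (that is, $\delta_{\mathbb{S}^3}=1.0139\ldots$). For all $\mu\ge 0$, $$H(\mu)\le\delta_{\mathbb{S}^3}\int_0^\infty\frac{r^2\,dr}{(r^2+1)^2}=\delta_{\mathbb{S}^3}\cdot\frac{\pi}{4}, \qquad F(\mu)<\int_{\mathbb{R}^3}\frac{dx}{(|x|^2+1)^2}=\pi^2 .$$ -/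

import Mathlib

/-- The `n`-th term (`n ≥ 1`) of the series for the three-sphere. -/
noncomputable def termS3 (μ : ℝ) (n : ℕ+) : ℝ :=
  ((n : ℝ) + 1) ^ 2 / ((n : ℝ) * ((n : ℝ) + 2) + μ ^ 2) ^ 2

/-- `H(μ) = μ ∑_{n ≥ 1} (n+1)² / (n(n+2) + μ²)²`. -/
noncomputable def HS3 (μ : ℝ) : ℝ :=
  μ * ∑' n : ℕ+, termS3 μ n

/-- The term with index `m ∈ ℤ³ ∖ {0}` of the lattice series for the three-torus, where `|m|`
is the Euclidean length. -/
noncomputable def termT3 (μ : ℝ) (m : {m : Fin 3 → ℤ // m ≠ 0}) : ℝ :=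
  1 / ((∑ i, (m.1 i : ℝ) ^ 2) + μ ^ 2) ^ 2

/-- `F(μ) = μ ∑_{m ∈ ℤ³ ∖ {0}} (|m|² + μ²)⁻²`. -/
noncomputable def FT3 (μ : ℝ) : ℝ :=
  μ * ∑' m : {m : Fin 3 → ℤ // m ≠ 0}, termT3 μ m

open Real MeasureTheory Set Filter Topology

/-! Torus: since `1 / A ^ 2 = ∫ t * exp (-A t)`, the lattice sum is a Laplace-type integral of `θ ^
3 - 1`, and replacing `θ ^ 3 - 1` by `(π / t) ^ (3 / 2)` gives exactly `π ^ 2 / μ`. Jacobi inversion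
yields this comparison with a margin `exp (-t) / 2` (`theta_cube_add_le`); the margin keeps the
inequality strict after the passage from finite sums to the series.

Sphere: `n (n + 2) = (n + 1) ^ 2 - 1`, so with `a ^ 2 = μ ^ 2 - 1 > 0` the cotangent expansion at `i
a` sums the series (`HS3_eq`). Up to exponentially small terms, `H` is `π / 4 * μ / a - 1 / μ ^ 3`,
which is bounded by a polynomial inequality in `1 / μ` (`HS3_le_of_ge`) and evaluated near its peak
(`le_HS3`). Small `μ` is handled term by term (`HS3_le_of_le`). The maximum exists by compactness,
since `H` beyond 10 stays below `H 3.3`. -/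

/-! ### The comparison integrals -/

lemma hasDerivAt_arctan_sub_div (r : ℝ) :
    HasDerivAt (fun r : ℝ => (arctan r - r / (r ^ 2 + 1)) / 2) (r ^ 2 / (r ^ 2 + 1) ^ 2) r := by
  have h0 : r ^ 2 + 1 ≠ 0 := by positivity
  have h1 : HasDerivAt (fun r : ℝ => r ^ 2 + 1) (2 * r) r := by
    simpa using (hasDerivAt_pow 2 r).add_const 1
  convert! ((hasDerivAt_arctan r).sub ((hasDerivAt_id r).div h1 h0)).div_const 2 using 1
  simp only [id]
  rw [show (1 : ℝ) + r ^ 2 = r ^ 2 + 1 by ring]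
  field_simp
  ring

lemma tendsto_arctan_sub_div :
    Tendsto (fun r : ℝ => (arctan r - r / (r ^ 2 + 1)) / 2) atTop (𝓝 (π / 4)) := by
  have h1 : Tendsto arctan atTop (𝓝 (π / 2)) := tendsto_nhds_of_tendsto_nhdsWithin tendsto_arctan_atTop
  have h2 : Tendsto (fun r : ℝ => r / (r ^ 2 + 1)) atTop (𝓝 0) := by
    refine squeeze_zero' (eventually_ge_atTop 0 |>.mono fun r hr => by positivity) ?_
      tendsto_inv_atTop_zero
    filter_upwards [eventually_gt_atTop 0] with r hr
    rw [div_le_iff₀ (by positivity)]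
    field_simp
    nlinarith
  convert! (h1.sub h2).div_const 2 using 2
  ring

lemma integrableOn_sq_div_sq :
    IntegrableOn (fun r : ℝ => r ^ 2 / (r ^ 2 + 1) ^ 2) (Ioi 0) :=
  integrableOn_Ioi_deriv_of_nonneg' (fun r _ => hasDerivAt_arctan_sub_div r)
    (fun r _ => by positivity) tendsto_arctan_sub_div

lemma integral_sq_div_sq : ∫ r in Ioi (0 : ℝ), r ^ 2 / (r ^ 2 + 1) ^ 2 = π / 4 := by
  rw [integral_Ioi_of_hasDerivAt_of_nonneg' (fun r _ => hasDerivAt_arctan_sub_div r)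
    (fun r _ => by positivity) tendsto_arctan_sub_div]
  simp

lemma integrable_one_div_norm_sq_add_one_sq :
    Integrable (fun x : EuclideanSpace ℝ (Fin 3) => 1 / (‖x‖ ^ 2 + 1) ^ 2) := by
  rw [integrable_fun_norm_addHaar volume (f := fun r : ℝ => 1 / (r ^ 2 + 1) ^ 2)]
  refine integrableOn_sq_div_sq.congr_fun (fun r _ => ?_) measurableSet_Ioi
  simp [div_eq_mul_inv]

lemma integral_one_div_norm_sq_add_one_sq :
    ∫ x : EuclideanSpace ℝ (Fin 3), 1 / (‖x‖ ^ 2 + 1) ^ 2 = π ^ 2 := by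
  rw [integral_fun_norm_addHaar volume (fun r : ℝ => 1 / (r ^ 2 + 1) ^ 2)]
  have h : ∫ y in Ioi (0 : ℝ), y ^ (Module.finrank ℝ (EuclideanSpace ℝ (Fin 3)) - 1) •
      (1 / (y ^ 2 + 1) ^ 2) = π / 4 := by
    rw [← integral_sq_div_sq]
    refine setIntegral_congr_fun measurableSet_Ioi (fun r _ => ?_)
    simp [div_eq_mul_inv]
  rw [h, Measure.real, EuclideanSpace.volume_ball_fin_three]
  have : (0 : ℝ) ≤ π * 4 / 3 := by positivity
  simp [ENNReal.toReal_ofReal this]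
  ring

/-! ### The theta function -/

lemma summable_exp_neg_mul_int_sq {t : ℝ} (ht : 0 < t) :
    Summable (fun n : ℤ => rexp (-t * (n : ℝ) ^ 2)) := by
  have h : 0 < ((t / π : ℝ) * Complex.I : ℂ).im := by simp; positivity
  have := (hasSum_jacobiTheta₂_term 0 h).summable.norm
  refine this.congr fun n => ?_
  rw [norm_jacobiTheta₂_term]
  congr 1
  simp
  field_simp

lemma tsum_exp_neg_mul_int_sq_le {s : ℝ} (hs : 0 < s) :
    ∑' n : ℤ, rexp (-π * s * (n : ℝ) ^ 2) ≤ 1 + 2 / (1 - rexp (-π * s)) * rexp (-π * s) := by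
  have h : 0 < ((s : ℝ) * Complex.I : ℂ).im := by simpa using hs
  have h1 := norm_jacobiTheta_sub_one_le h
  have h2 : jacobiTheta ((s : ℝ) * Complex.I) =
      ((∑' n : ℤ, rexp (-π * s * (n : ℝ) ^ 2) : ℝ) : ℂ) := by
    rw [jacobiTheta, Complex.ofReal_tsum]
    refine tsum_congr fun n => ?_
    push_cast
    congr 1
    linear_combination (π * s * n ^ 2 : ℂ) * Complex.I_sq
  rw [h2, ← Complex.ofReal_one, ← Complex.ofReal_sub, Complex.norm_real] at h1
  have := (le_abs_self _).trans h1
  simp at this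
  simp
  linarith

lemma exp_neg_pi_mul_le {s : ℝ} (hs : 1 ≤ s) : rexp (-π * s) * s ^ 2 ≤ 1 / 20 := by
  have h3 : (20 : ℝ) ≤ rexp 3 := by
    rw [show (3 : ℝ) = (3 : ℕ) * 1 by norm_num, Real.exp_nat_mul]
    have := Real.exp_one_gt_d9
    calc (20 : ℝ) ≤ 2.718 ^ 3 := by norm_num
      _ ≤ _ := by gcongr; linarith
  have h1 : s ≤ rexp (s - 1) := by linarith [Real.add_one_le_exp (s - 1)]
  -- For `s ≥ 1`, `π s ≥ 3 s ≥ 2 (s - 1) + 3`.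
  have h2 : s ^ 2 * 20 ≤ rexp (π * s) := by
    calc s ^ 2 * 20 ≤ rexp (s - 1) ^ 2 * rexp 3 := by gcongr
      _ = rexp (2 * (s - 1) + 3) := by rw [Real.exp_add, ← Real.exp_nat_mul]; norm_num
      _ ≤ _ := by
        gcongr
        nlinarith [Real.pi_gt_three]
  rw [neg_mul, Real.exp_neg, inv_mul_le_iff₀ (Real.exp_pos _)]
  linarith

lemma rpow_three_halves_le_sq {s : ℝ} (hs : 1 ≤ s) : s ^ (3 / 2 : ℝ) ≤ s ^ 2 := by
  rw [← Real.rpow_natCast]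
  exact Real.rpow_le_rpow_of_exponent_le hs (by norm_num)

lemma theta_cube_sub_one_mul_le {s : ℝ} (hs : 1 ≤ s) :
    ((∑' n : ℤ, rexp (-π * s * (n : ℝ) ^ 2)) ^ 3 - 1) * s ^ (3 / 2 : ℝ) ≤ 2 / 5 := by
  have h1 := tsum_exp_neg_mul_int_sq_le (by linarith : 0 < s)
  have h0 : 0 ≤ ∑' n : ℤ, rexp (-π * s * (n : ℝ) ^ 2) := tsum_nonneg fun _ => by positivity
  set θ := ∑' n : ℤ, rexp (-π * s * (n : ℝ) ^ 2)
  have h2 := exp_neg_pi_mul_le hs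
  have hx0 : 0 < rexp (-π * s) := Real.exp_pos _
  set x := rexp (-π * s)
  have hx : x ≤ 1 / 20 := (le_mul_of_one_le_right hx0.le (one_le_pow₀ hs)).trans h2
  have h3 : θ ≤ 1 + 40 / 19 * x := by
    have h4 : 2 / (1 - x) ≤ 40 / 19 := by
      rw [div_le_iff₀ (by linarith)]
      linarith
    nlinarith [mul_le_mul_of_nonneg_right h4 hx0.le]
  have h4 : θ ^ 3 - 1 ≤ 8 * x := by
    have : θ ^ 3 ≤ (1 + 40 / 19 * x) ^ 3 := by gcongr
    nlinarith [mul_nonneg hx0.le (sub_nonneg.2 hx), mul_nonneg (sq_nonneg x) (sub_nonneg.2 hx)]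
  have h5 := rpow_three_halves_le_sq hs
  have h6 : 0 < s ^ (3 / 2 : ℝ) := by positivity
  nlinarith [mul_le_mul_of_nonneg_right h4 h6.le, mul_le_mul_of_nonneg_left h5 hx0.le]

/-- For `s ≥ 1` both terms are exponentially small. For `s ≤ 1`, inversion turns `θ(s) ^ 3` into `s
^ (-3 / 2) * θ(1 / s) ^ 3`, whose excess over `s ^ (-3 / 2)` is at most `2 / 5`; this leaves room
for `1 / 2` below the `1` that is subtracted. -/
lemma theta_cube_add_le {s : ℝ} (hs : 0 < s) :
    (∑' n : ℤ, rexp (-π * s * (n : ℝ) ^ 2)) ^ 3 - 1 + 1 / 2 * rexp (-π * s) ≤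
      (1 / s) ^ (3 / 2 : ℝ) := by
  rcases le_total 1 s with h | h
  · have h1 := theta_cube_sub_one_mul_le h
    have h2 := exp_neg_pi_mul_le h
    have h3 := rpow_three_halves_le_sq h
    have h6 : 0 < s ^ (3 / 2 : ℝ) := by positivity
    have hx0 : 0 < rexp (-π * s) := Real.exp_pos _
    rw [Real.div_rpow zero_le_one hs.le, Real.one_rpow, le_div_iff₀ h6]
    nlinarith [mul_le_mul_of_nonneg_left h3 hx0.le]
  · have hu : 1 ≤ 1 / s := by rw [le_div_iff₀ hs]; linarith
    have h1 := theta_cube_sub_one_mul_le hu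
    have h2 : rexp (-π * s) ≤ 1 := by
      rw [Real.exp_le_one_iff]
      nlinarith [Real.pi_pos]
    rw [Real.tsum_exp_neg_mul_int_sq hs, mul_pow]
    have h3 : ((1 : ℝ) / s ^ (1 / 2 : ℝ)) ^ 3 = (1 / s) ^ (3 / 2 : ℝ) := by
      rw [Real.div_rpow zero_le_one hs.le, Real.one_rpow, div_pow, one_pow, ← Real.rpow_natCast,
        ← Real.rpow_mul hs.le]
      norm_num
    rw [h3]
    simp only [mul_one_div] at h1
    linarith

lemma sum_exp_neg_mul_add_le {t : ℝ} (ht : 0 < t) (S : Finset {m : Fin 3 → ℤ // m ≠ 0}) :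
    ∑ m ∈ S, rexp (-t * ∑ i, (m.1 i : ℝ) ^ 2) + 1 / 2 * rexp (-t) ≤ (π / t) ^ (3 / 2 : ℝ) := by
  have key := theta_cube_add_le (s := t / π) (by positivity)
  have e : -π * (t / π) = -t := by field_simp
  rw [e, one_div_div] at key
  refine le_trans ?_ key
  gcongr
  have hsum := summable_exp_neg_mul_int_sq ht
  let T : Finset (Fin 3 → ℤ) := insert 0 (S.map ⟨Subtype.val, Subtype.val_injective⟩)
  have hT : ∑ m ∈ T, rexp (-t * ∑ i, (m i : ℝ) ^ 2) =
      1 + ∑ m ∈ S, rexp (-t * ∑ i, (m.1 i : ℝ) ^ 2) := by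
    rw [Finset.sum_insert (by simp), Finset.sum_map]
    simp
  -- `U` collects all coordinates, so `T` lies in the cube `U ^ 3`, over which the Gaussian sum
  -- factorizes.
  let U : Finset ℤ := T.biUnion fun m => Finset.univ.image m
  have hTU : T ⊆ Fintype.piFinset fun _ : Fin 3 => U := by
    intro m hm
    rw [Fintype.mem_piFinset]
    intro i
    exact Finset.mem_biUnion.2 ⟨m, hm, Finset.mem_image_of_mem _ (Finset.mem_univ i)⟩
  have h1 : ∑ m ∈ T, rexp (-t * ∑ i, (m i : ℝ) ^ 2) ≤
      (∑ n ∈ U, rexp (-t * (n : ℝ) ^ 2)) ^ 3 := by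
    refine (Finset.sum_le_sum_of_subset_of_nonneg hTU fun _ _ _ => by positivity).trans_eq ?_
    have := Finset.prod_univ_sum (fun _ : Fin 3 => U) (fun _ n => rexp (-t * (n : ℝ) ^ 2))
    simp only [Finset.prod_const, Finset.card_univ, Fintype.card_fin] at this
    rw [this]
    refine Finset.sum_congr rfl fun m _ => ?_
    rw [Finset.mul_sum, Real.exp_sum]
  have h2 : (∑ n ∈ U, rexp (-t * (n : ℝ) ^ 2)) ^ 3 ≤ (∑' n : ℤ, rexp (-t * (n : ℝ) ^ 2)) ^ 3 := by
    gcongr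
    exact hsum.sum_le_tsum _ fun _ _ => by positivity
  linarith

/-! ### The torus -/

lemma integral_id_mul_exp_neg_mul {A : ℝ} (hA : 0 < A) :
    ∫ t in Ioi (0 : ℝ), t * rexp (-(A * t)) = 1 / A ^ 2 := by
  have := integral_rpow_mul_exp_neg_mul_Ioi (a := 2) (by norm_num) hA
  norm_num at this
  simpa using this

lemma integrableOn_id_mul_exp_neg_mul {A : ℝ} (hA : 0 < A) :
    IntegrableOn (fun t => t * rexp (-(A * t))) (Ioi 0) :=
  -- A non-integrable function has integral `0` by convention, so a nonzero value proves
  -- integrability.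
  .of_integral_ne_zero (by rw [integral_id_mul_exp_neg_mul hA]; positivity)

lemma integral_mul_rpow_mul_exp {μ : ℝ} (hμ : 0 < μ) :
    ∫ t in Ioi (0 : ℝ), t * (π / t) ^ (3 / 2 : ℝ) * rexp (-(μ ^ 2 * t)) = π ^ 2 / μ := by
  have h := integral_rpow_mul_exp_neg_mul_Ioi (a := 1 / 2) (by norm_num) (pow_pos hμ 2)
  have h1 : ∀ t ∈ Ioi (0 : ℝ), t * (π / t) ^ (3 / 2 : ℝ) * rexp (-(μ ^ 2 * t)) =
      π ^ (3 / 2 : ℝ) * (t ^ (1 / 2 - 1 : ℝ) * rexp (-(μ ^ 2 * t))) := by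
    intro t (ht : 0 < t)
    rw [Real.div_rpow Real.pi_pos.le ht.le, show (1 / 2 - 1 : ℝ) = 1 - 3 / 2 by norm_num,
      Real.rpow_sub ht, Real.rpow_one]
    ring
  rw [setIntegral_congr_fun measurableSet_Ioi h1, integral_const_mul, h, Real.Gamma_one_half_eq,
    ← Real.sqrt_eq_rpow, one_div, Real.sqrt_inv, Real.sqrt_sq hμ.le, Real.sqrt_eq_rpow]
  rw [mul_left_comm, ← Real.rpow_add Real.pi_pos]
  norm_num
  ring

lemma sum_termT3_add_le {μ : ℝ} (hμ : 0 < μ) (S : Finset {m : Fin 3 → ℤ // m ≠ 0}) :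
    ∑ m ∈ S, termT3 μ m + 1 / 2 * (1 / (1 + μ ^ 2) ^ 2) ≤ π ^ 2 / μ := by
  have hA : ∀ m : {m : Fin 3 → ℤ // m ≠ 0}, 0 < (∑ i, (m.1 i : ℝ) ^ 2) + μ ^ 2 := fun m => by
    positivity
  have hB : 0 < 1 + μ ^ 2 := by positivity
  have e1 : ∑ m ∈ S, termT3 μ m + 1 / 2 * (1 / (1 + μ ^ 2) ^ 2) =
      ∫ t in Ioi (0 : ℝ), (∑ m ∈ S, t * rexp (-(((∑ i, (m.1 i : ℝ) ^ 2) + μ ^ 2) * t)) +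
        1 / 2 * (t * rexp (-((1 + μ ^ 2) * t)))) := by
    rw [integral_add (integrable_finsetSum _ fun m _ => integrableOn_id_mul_exp_neg_mul (hA m))
      ((integrableOn_id_mul_exp_neg_mul hB).const_mul _),
      integral_finsetSum _ fun m _ => integrableOn_id_mul_exp_neg_mul (hA m), integral_const_mul,
      integral_id_mul_exp_neg_mul hB]
    simp only [integral_id_mul_exp_neg_mul (hA _)]
    rfl
  rw [e1, ← integral_mul_rpow_mul_exp hμ]
  refine setIntegral_mono_on ?_ (.of_integral_ne_zero ?_) measurableSet_Ioi ?_
  · exact (integrable_finsetSum _ fun m _ => integrableOn_id_mul_exp_neg_mul (hA m)).add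
      ((integrableOn_id_mul_exp_neg_mul hB).const_mul _)
  · rw [integral_mul_rpow_mul_exp hμ]
    positivity
  · intro t (ht : 0 < t)
    have h := mul_le_mul_of_nonneg_left (sum_exp_neg_mul_add_le ht S)
      (mul_nonneg ht.le (Real.exp_pos (-(μ ^ 2 * t))).le)
    refine le_trans (le_of_eq ?_) (h.trans_eq (by ring))
    rw [mul_add, Finset.mul_sum]
    congr 1
    · refine Finset.sum_congr rfl fun m _ => ?_
      rw [mul_assoc, ← Real.exp_add]
      ring_nf
    · rw [show t * rexp (-(μ ^ 2 * t)) * (1 / 2 * rexp (-t)) =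
        1 / 2 * (t * (rexp (-(μ ^ 2 * t)) * rexp (-t))) by ring, ← Real.exp_add]
      ring_nf

lemma termT3_nonneg (μ : ℝ) (m : {m : Fin 3 → ℤ // m ≠ 0}) : 0 ≤ termT3 μ m := by
  unfold termT3
  positivity

lemma one_le_sum_sq {m : Fin 3 → ℤ} (hm : m ≠ 0) : (1 : ℝ) ≤ ∑ i, (m i : ℝ) ^ 2 := by
  obtain ⟨i, hi⟩ := Function.ne_iff.1 hm
  have h1 : (1 : ℝ) ≤ (m i : ℝ) ^ 2 := by
    have : (1 : ℤ) ≤ m i ^ 2 := Int.one_le_abs (pow_ne_zero 2 hi) |>.trans_eq (abs_of_nonneg (sq_nonneg _))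
    exact_mod_cast this
  exact h1.trans (Finset.single_le_sum (f := fun i => (m i : ℝ) ^ 2) (fun _ _ => sq_nonneg _)
    (Finset.mem_univ i))

lemma summable_termT3 (μ : ℝ) : Summable (termT3 μ) := by
  have h1 : Summable (termT3 1) :=
    summable_of_sum_le (termT3_nonneg 1) (c := π ^ 2 / 1) fun S => by
      have := sum_termT3_add_le one_pos S
      norm_num at this ⊢
      linarith
  -- As `|m| ^ 2 ≥ 1`, one has `|m| ^ 2 + 1 ≤ 2 (|m| ^ 2 + μ ^ 2)`, even at `μ = 0`; squaring gives
  -- the factor 4.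
  refine Summable.of_nonneg_of_le (termT3_nonneg μ) (fun m => ?_) (h1.mul_left 4)
  have h := one_le_sum_sq m.2
  unfold termT3
  set A := ∑ i, (m.1 i : ℝ) ^ 2
  rw [mul_one_div, div_le_div_iff₀ (by positivity) (by positivity)]
  have : A + 1 ^ 2 ≤ 2 * (A + μ ^ 2) := by nlinarith [sq_nonneg μ]
  calc 1 * (A + 1 ^ 2) ^ 2 ≤ 1 * (2 * (A + μ ^ 2)) ^ 2 := by gcongr
    _ = _ := by ring

lemma FT3_lt_pi_sq {μ : ℝ} (hμ : 0 ≤ μ) : FT3 μ < π ^ 2 := by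
  rcases hμ.eq_or_lt with rfl | hμ
  · simp only [FT3, zero_mul]
    positivity
  have h : ∑' m, termT3 μ m ≤ π ^ 2 / μ - 1 / 2 * (1 / (1 + μ ^ 2) ^ 2) :=
    (summable_termT3 μ).tsum_le_of_sum_le fun S => by linarith [sum_termT3_add_le hμ S]
  have h2 : 0 < 1 / 2 * (1 / (1 + μ ^ 2) ^ 2) := by positivity
  have h3 : ∑' m, termT3 μ m < π ^ 2 / μ := by linarith
  rw [lt_div_iff₀ hμ] at h3
  rw [FT3, mul_comm]
  exact h3

/-! ### Lattice sums from the partial fractions of the cotangent -/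

lemma ofReal_mul_I_mem_upperHalfPlaneSet {a : ℝ} (ha : 0 < a) :
    (a * Complex.I : ℂ) ∈ UpperHalfPlane.upperHalfPlaneSet := by
  simpa [UpperHalfPlane.upperHalfPlaneSet] using ha

lemma sin_pi_mul_ofReal_mul_I (a : ℝ) :
    Complex.sin (π * (a * Complex.I)) = (sinh (π * a) : ℝ) * Complex.I := by
  rw [← mul_assoc, Complex.sin_mul_I]
  push_cast
  rfl

lemma cos_pi_mul_ofReal_mul_I (a : ℝ) :
    Complex.cos (π * (a * Complex.I)) = (cosh (π * a) : ℝ) := by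
  rw [← mul_assoc, Complex.cos_mul_I]
  push_cast
  rfl

lemma tsum_one_div_sq_add_sq {a : ℝ} (ha : 0 < a) :
    ∑' n : ℕ+, 1 / ((n : ℝ) ^ 2 + a ^ 2) =
      (π * (cosh (π * a) / sinh (π * a)) - 1 / a) / (2 * a) := by
  have hz := cot_series_rep
    (UpperHalfPlane.coe_mem_integerComplement ⟨_, ofReal_mul_I_mem_upperHalfPlaneSet ha⟩)
  simp only at hz
  have hS : sinh (π * a) ≠ 0 := (Real.sinh_pos_iff.2 (by positivity)).ne'
  have ha' : (a : ℂ) ≠ 0 := by exact_mod_cast ha.ne'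
  have h1 : ∀ n : ℕ+, 1 / ((a * Complex.I : ℂ) - n) + 1 / ((a * Complex.I : ℂ) + n) =
      ((1 / ((n : ℝ) ^ 2 + a ^ 2) : ℝ) : ℂ) * (-2 * a * Complex.I) := by
    intro n
    have hn : ((n : ℝ) ^ 2 + a ^ 2 : ℝ) ≠ 0 := by positivity
    have hn' : ((n : ℂ) ^ 2 + (a : ℂ) ^ 2) ≠ 0 := by exact_mod_cast hn
    have e : ((a * Complex.I : ℂ) - n) * ((a * Complex.I : ℂ) + n) = -((n : ℂ) ^ 2 + (a : ℂ) ^ 2) := by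
      linear_combination (a : ℂ) ^ 2 * Complex.I_sq
    have e0 : ((a * Complex.I : ℂ) - n) * ((a * Complex.I : ℂ) + n) ≠ 0 := by
      rw [e]
      exact neg_ne_zero.2 hn'
    rw [one_div_add_one_div (left_ne_zero_of_mul e0) (right_ne_zero_of_mul e0), e]
    push_cast
    field_simp
    ring
  rw [Complex.cot, sin_pi_mul_ofReal_mul_I, cos_pi_mul_ofReal_mul_I, tsum_congr h1,
    tsum_mul_right, ← Complex.ofReal_tsum] at hz
  have h2 : π * (cosh (π * a) / sinh (π * a)) =
      1 / a + (∑' n : ℕ+, 1 / ((n : ℝ) ^ 2 + a ^ 2)) * (2 * a) := by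
    have hS' : ((sinh (π * a) : ℝ) : ℂ) ≠ 0 := by exact_mod_cast hS
    apply Complex.ofReal_injective
    rw [← mul_right_inj' (neg_ne_zero.2 Complex.I_ne_zero)]
    generalize (∑' n : ℕ+, 1 / ((n : ℝ) ^ 2 + a ^ 2)) = T at hz
    generalize sinh (π * a) = s at hz hS'
    generalize cosh (π * a) = c at hz
    push_cast
    have e1 : (π : ℂ) * (c / (s * Complex.I)) = -Complex.I * (π * (c / s)) := by
      rw [div_mul_eq_div_div, Complex.div_I]
      ring
    have e2 : (1 : ℂ) / (a * Complex.I) = -Complex.I * (1 / a) := by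
      rw [div_mul_eq_div_div, Complex.div_I]
      ring
    rw [e1, e2] at hz
    rw [hz]
    ring
  rw [eq_div_iff (by positivity)]
  linarith

lemma deriv_pi_mul_cot_pi_mul {z : ℂ} (hz : Complex.sin (π * z) ≠ 0) :
    deriv (fun x : ℂ => π * Complex.cot (π * x)) z = -π ^ 2 / Complex.sin (π * z) ^ 2 := by
  have h0 : HasDerivAt (fun x : ℂ => (π : ℂ) * x) π z := by
    simpa using (hasDerivAt_id z).const_mul (π : ℂ)
  have h := (((Complex.hasDerivAt_cos (π * z)).comp z h0).div
    ((Complex.hasDerivAt_sin (π * z)).comp z h0) hz).const_mul (π : ℂ)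
  refine (h.congr_deriv ?_).deriv
  simp only [Function.comp_apply]
  rw [mul_div_assoc', div_left_inj' (pow_ne_zero 2 hz)]
  linear_combination (-π ^ 2 : ℂ) * Complex.sin_sq_add_cos_sq (π * z)

lemma re_one_div_ofReal_mul_I_add_sq {a : ℝ} (ha : 0 < a) (x : ℝ) :
    (1 / ((a * Complex.I : ℂ) + x) ^ 2).re = (x ^ 2 - a ^ 2) / (x ^ 2 + a ^ 2) ^ 2 := by
  have hx : x ^ 2 + a ^ 2 ≠ 0 := by positivity
  have hx' : ((x : ℂ) ^ 2 + (a : ℂ) ^ 2) ≠ 0 := by exact_mod_cast hx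
  have e : ((a * Complex.I : ℂ) + x) * (x - a * Complex.I) = (x : ℂ) ^ 2 + (a : ℂ) ^ 2 := by
    linear_combination (-(a : ℂ) ^ 2) * Complex.I_sq
  have h0 : (a * Complex.I : ℂ) + x ≠ 0 := left_ne_zero_of_mul (e ▸ hx')
  have h1 : 1 / ((a * Complex.I : ℂ) + x) ^ 2 =
      (((x ^ 2 - a ^ 2) / (x ^ 2 + a ^ 2) ^ 2 : ℝ) : ℂ) +
        ((-2 * x * a / (x ^ 2 + a ^ 2) ^ 2 : ℝ) : ℂ) * Complex.I := by
    push_cast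
    rw [← e]
    have h2 : (x - a * Complex.I : ℂ) ≠ 0 := right_ne_zero_of_mul (e ▸ hx')
    field_simp
    linear_combination ((a : ℂ) ^ 2) * Complex.I_sq
  rw [h1, Complex.add_re, Complex.ofReal_re, Complex.re_ofReal_mul, Complex.I_re]
  ring

/-- Differentiating the cotangent series gives `∑ 1 / (z + n) ^ 2 = π ^ 2 / sin (π z) ^ 2`; this is
its real part at `z = i a`, folded onto positive `n`. -/
lemma tsum_sq_sub_sq_div {a : ℝ} (ha : 0 < a) :
    ∑' n : ℕ+, ((n : ℝ) ^ 2 - a ^ 2) / ((n : ℝ) ^ 2 + a ^ 2) ^ 2 =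
      (1 / a ^ 2 - π ^ 2 / sinh (π * a) ^ 2) / 2 := by
  have hz := ofReal_mul_I_mem_upperHalfPlaneSet ha
  have hS : sinh (π * a) ≠ 0 := (Real.sinh_pos_iff.2 (by positivity)).ne'
  have hsum : Summable fun n : ℤ => 1 / ((a * Complex.I : ℂ) + n) ^ 2 := by
    have := EisensteinSeries.linear_right_summable (a * Complex.I : ℂ) 1 (k := 2) le_rfl
    refine this.congr fun n => ?_
    simp [zpow_ofNat]
  have h := iteratedDerivWithin_cot_pi_mul_eq_mul_tsum_div_pow (k := 1) le_rfl hz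
  have hsin : Complex.sin (π * (a * Complex.I)) ≠ 0 := by
    rw [sin_pi_mul_ofReal_mul_I]
    exact mul_ne_zero (by exact_mod_cast hS) Complex.I_ne_zero
  rw [iteratedDerivWithin_one, derivWithin_of_isOpen UpperHalfPlane.isOpen_upperHalfPlaneSet hz,
    deriv_pi_mul_cot_pi_mul hsin, sin_pi_mul_ofReal_mul_I] at h
  have h2 : ∑' n : ℤ, 1 / ((a * Complex.I : ℂ) + n) ^ 2 =
      ((-π ^ 2 / sinh (π * a) ^ 2 : ℝ) : ℂ) := by
    norm_num at h
    rw [mul_pow, Complex.I_sq] at h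
    push_cast
    simp only [one_div]
    have h3 := congrArg Neg.neg h
    simp only [neg_neg] at h3
    rw [← h3]
    ring
  have hre := Complex.re_tsum hsum
  have hre2 : ∀ n : ℤ, (1 / ((a * Complex.I : ℂ) + n) ^ 2).re =
      ((n : ℝ) ^ 2 - a ^ 2) / ((n : ℝ) ^ 2 + a ^ 2) ^ 2 := fun n => by
    exact_mod_cast re_one_div_ofReal_mul_I_add_sq ha n
  rw [h2, Complex.ofReal_re, tsum_congr hre2, tsum_int_eq_zero_add_two_mul_tsum_pnat] at hre
  · simp only [Int.cast_zero, nsmul_eq_mul, Int.cast_natCast] at hre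
    have e : ((0 : ℝ) ^ 2 - a ^ 2) / (0 ^ 2 + a ^ 2) ^ 2 = -(1 / a ^ 2) := by
      field_simp
      ring
    rw [e] at hre
    push_cast at hre
    rw [eq_div_iff two_ne_zero]
    linear_combination -hre
  · intro n
    simp
  · exact (Complex.reCLM.summable hsum).congr fun n => by rw [← hre2]; rfl

lemma summable_one_div_pnat_sq : Summable fun n : ℕ+ => 1 / (n : ℝ) ^ 2 :=
  summable_pnat_iff_summable_nat (f := fun n : ℕ => 1 / (n : ℝ) ^ 2) |>.2 hasSum_zeta_two.summable

lemma summable_one_div_pnat_add_one_sq : Summable fun n : ℕ+ => 1 / ((n : ℝ) + 1) ^ 2 :=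
  summable_one_div_pnat_sq.of_nonneg_of_le (fun n => by positivity) fun n => by
    gcongr
    linarith

lemma tsum_one_div_pnat_add_one_sq : ∑' n : ℕ+, 1 / ((n : ℝ) + 1) ^ 2 = π ^ 2 / 6 - 1 := by
  have h := hasSum_zeta_two
  rw [tsum_pnat_eq_tsum_succ (f := fun n : ℕ => 1 / ((n : ℝ) + 1) ^ 2), ← h.tsum_eq,
    ← h.summable.sum_add_tsum_nat_add 2]
  norm_num [Finset.sum_range_succ]
  refine tsum_congr fun n => ?_
  norm_num [add_assoc]

lemma tsum_pnat_succ {f : ℕ → ℝ} (hf : Summable fun n : ℕ+ => f n) :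
    ∑' n : ℕ+, f (n + 1) = ∑' n : ℕ+, f n - f 1 := by
  have h := summable_pnat_iff_summable_succ.1 hf
  rw [tsum_pnat_eq_tsum_succ (f := f), tsum_pnat_eq_tsum_succ (f := fun n => f (n + 1)),
    h.tsum_eq_zero_add]
  simp

lemma summable_sq_div_sq_add_sq (a : ℝ) :
    Summable fun n : ℕ+ => (n : ℝ) ^ 2 / ((n : ℝ) ^ 2 + a ^ 2) ^ 2 := by
  refine summable_one_div_pnat_sq.of_nonneg_of_le (fun n => by positivity) fun n => ?_
  rw [div_le_div_iff₀ (by positivity) (by positivity), one_mul, ← sq]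
  gcongr
  nlinarith [sq_nonneg a]

lemma tsum_sq_div_sq_add_sq {a : ℝ} (ha : 0 < a) :
    ∑' n : ℕ+, (n : ℝ) ^ 2 / ((n : ℝ) ^ 2 + a ^ 2) ^ 2 =
      π / 4 * (cosh (π * a) / sinh (π * a) / a - π / sinh (π * a) ^ 2) := by
  have h1 : Summable fun n : ℕ+ => 1 / ((n : ℝ) ^ 2 + a ^ 2) :=
    summable_one_div_pnat_sq.of_nonneg_of_le (fun n => by positivity) fun n => by
      gcongr
      nlinarith [sq_nonneg a]
  have e : ∀ n : ℕ+, ((n : ℝ) ^ 2 - a ^ 2) / ((n : ℝ) ^ 2 + a ^ 2) ^ 2 =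
      2 * ((n : ℝ) ^ 2 / ((n : ℝ) ^ 2 + a ^ 2) ^ 2) - 1 / ((n : ℝ) ^ 2 + a ^ 2) := fun n => by
    field_simp
    ring
  have h2 := tsum_sq_sub_sq_div ha
  rw [tsum_congr e, ((summable_sq_div_sq_add_sq a).mul_left 2).tsum_sub h1, tsum_mul_left,
    tsum_one_div_sq_add_sq ha] at h2
  have h3 : ∑' n : ℕ+, (n : ℝ) ^ 2 / ((n : ℝ) ^ 2 + a ^ 2) ^ 2 =
      ((1 / a ^ 2 - π ^ 2 / sinh (π * a) ^ 2) / 2 +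
        (π * (cosh (π * a) / sinh (π * a)) - 1 / a) / (2 * a)) / 2 := by linarith
  rw [h3]
  field_simp
  ring

/-! ### The sphere -/

lemma termS3_nonneg (μ : ℝ) (n : ℕ+) : 0 ≤ termS3 μ n := by
  unfold termS3
  positivity

/-- A majorant independent of `μ`, giving both convergence and continuity of `HS3`. -/
lemma termS3_le (μ : ℝ) (n : ℕ+) : termS3 μ n ≤ 2 * (1 / ((n : ℝ) + 1) ^ 2) := by
  have hn : (1 : ℝ) ≤ n := by exact Nat.one_le_cast.2 n.pos
  unfold termS3
  rw [mul_one_div, div_le_div_iff₀ (by positivity) (by positivity)]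
  have h : 3 / 4 * ((n : ℝ) + 1) ^ 2 ≤ (n : ℝ) * (n + 2) + μ ^ 2 := by nlinarith [sq_nonneg μ]
  calc ((n : ℝ) + 1) ^ 2 * (n + 1) ^ 2 ≤ 2 * (3 / 4 * ((n : ℝ) + 1) ^ 2) ^ 2 := by
        nlinarith [pow_pos (show (0 : ℝ) < n + 1 by positivity) 4]
    _ ≤ _ := by gcongr

lemma summable_termS3 (μ : ℝ) : Summable (termS3 μ) :=
  (summable_one_div_pnat_add_one_sq.mul_left 2).of_nonneg_of_le (termS3_nonneg μ) (termS3_le μ)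

lemma continuous_HS3 : Continuous HS3 := by
  refine continuous_id.mul (continuous_tsum (fun n => ?_)
    (summable_one_div_pnat_add_one_sq.mul_left 2) fun n μ => ?_)
  · unfold termS3
    refine continuous_const.div (by fun_prop) fun μ => ?_
    positivity
  · rw [Real.norm_of_nonneg (termS3_nonneg μ n)]
    exact termS3_le μ n

lemma HS3_eq {μ a : ℝ} (ha : 0 < a) (h : a ^ 2 = μ ^ 2 - 1) :
    HS3 μ = μ * (π / 4 * (cosh (π * a) / sinh (π * a) / a - π / sinh (π * a) ^ 2) -
      1 / μ ^ 4) := by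
  rw [HS3, ← tsum_sq_div_sq_add_sq ha]
  congr 1
  have := tsum_pnat_succ (summable_sq_div_sq_add_sq a)
    (f := fun n => (n : ℝ) ^ 2 / ((n : ℝ) ^ 2 + a ^ 2) ^ 2)
  rw [show (1 : ℝ) / μ ^ 4 = ((1 : ℕ) : ℝ) ^ 2 / (((1 : ℕ) : ℝ) ^ 2 + a ^ 2) ^ 2 by
    rw [h]; push_cast; ring, ← this]
  refine tsum_congr fun n => ?_
  rw [termS3, h]
  push_cast
  ring

/-- With `x = π a`, clearing denominators leaves `exp (-x) * sinh x = (1 - exp (-2 x)) / 2 ≤ x`. -/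
lemma cosh_div_sinh_div_sub_le {a : ℝ} (ha : 0 < a) :
    cosh (π * a) / sinh (π * a) / a - π / sinh (π * a) ^ 2 ≤ 1 / a := by
  have hx : 0 < π * a := by positivity
  have hS := Real.sinh_pos_iff.2 hx
  have h1 : rexp (-(π * a)) * sinh (π * a) ≤ π * a := by
    have h2 : rexp (-(2 * (π * a))) = rexp (-(π * a)) * rexp (-(π * a)) := by
      rw [← Real.exp_add]; ring_nf
    have h3 : rexp (-(π * a)) * rexp (π * a) = 1 := by rw [← Real.exp_add]; simp
    rw [Real.sinh_eq]
    have := Real.add_one_le_exp (-(2 * (π * a)))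
    nlinarith
  rw [← Real.cosh_sub_sinh] at h1
  have : cosh (π * a) / sinh (π * a) / a - π / sinh (π * a) ^ 2 - 1 / a =
      ((cosh (π * a) - sinh (π * a)) * sinh (π * a) - π * a) / (a * sinh (π * a) ^ 2) := by
    field_simp
    ring
  rw [← sub_nonpos, this]
  exact div_nonpos_of_nonpos_of_nonneg (by linarith) (by positivity)

lemma HS3_le_of_one_lt {μ a : ℝ} (hμ : 0 < μ) (ha : 0 < a) (h : a ^ 2 = μ ^ 2 - 1) :
    HS3 μ ≤ π / 4 * (μ / a) - 1 / μ ^ 3 := by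
  rw [HS3_eq ha h]
  have := mul_le_mul_of_nonneg_left (cosh_div_sinh_div_sub_le ha)
    (show 0 ≤ μ * (π / 4) by positivity)
  have e : μ * (1 / μ ^ 4) = 1 / μ ^ 3 := by field_simp
  have e2 : μ * (π / 4) * (1 / a) = π / 4 * (μ / a) := by ring
  linarith

lemma le_HS3_of_one_lt {μ a : ℝ} (hμ : 0 < μ) (ha : 0 < a) (h : a ^ 2 = μ ^ 2 - 1) :
    π / 4 * (μ / a - π * μ / sinh (π * a) ^ 2) - 1 / μ ^ 3 ≤ HS3 μ := by
  rw [HS3_eq ha h]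
  have hS := Real.sinh_pos_iff.2 (show 0 < π * a by positivity)
  have h1 : 1 / a ≤ cosh (π * a) / sinh (π * a) / a := by
    gcongr
    rw [one_le_div hS]
    exact (Real.sinh_lt_cosh _).le
  have := mul_le_mul_of_nonneg_left h1 (show 0 ≤ μ * (π / 4) by positivity)
  have e : μ * (1 / μ ^ 4) = 1 / μ ^ 3 := by field_simp
  have e2 : μ * (π / 4) * (1 / a) = π / 4 * (μ / a) := by ring
  have e3 : π / 4 * (π * μ / sinh (π * a) ^ 2) = μ * (π / 4) * (π / sinh (π * a) ^ 2) := by ring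
  linarith

/-- This is `1 / √(1 - t ^ 2) - 1.2732 t ^ 3 ≤ 1.01399` with `t = 1 / μ`, where `1.2732` is just
below `4 / π`. The left side has a critical point near `t = 0.3023`, so the difference of the
squared inequality is nearly `(t - 0.3023) ^ 2` times the sextic in `hQ`. -/
lemma one_le_sq_mul_one_sub_sq {t : ℝ} (h0 : 0 ≤ t) (h1 : t ≤ 25 / 32) :
    1 ≤ (1.01399 + 1.2732 * t ^ 3) ^ 2 * (1 - t ^ 2) := by
  have hQ : 0 ≤ 0.30662 + 2.02872 * t - 1.18436 * t ^ 2 - 1.78107 * t ^ 3 + 1.17662 * t ^ 4 -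
      0.98008 * t ^ 5 - 1.62104 * t ^ 6 := by
    have h2 : t * t ≤ 25 / 32 * (25 / 32) := by gcongr
    have h3 : t ^ 4 ≤ (25 / 32) ^ 4 := by gcongr
    have h4 : t ^ 5 ≤ (25 / 32) ^ 5 := by gcongr
    -- On this range `0.39 * t ≤ 0.30662`, so `t` times this quantity bounds the sextic from below.
    have hN : 0 ≤ 2.02872 - 1.18436 * t - 1.78107 * t ^ 2 + 1.17662 * t ^ 3 -
        0.98008 * t ^ 4 - 1.62104 * t ^ 5 + 0.39 := by
      nlinarith [mul_nonneg (sub_nonneg.2 h1) h0,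
        mul_nonneg (sub_nonneg.2 h1) (show 0 ≤ 1.78107 * (25 / 32 + t) -
          1.17662 * ((25 / 32) ^ 2 + 25 / 32 * t + t ^ 2) by nlinarith)]
    nlinarith [mul_nonneg h0 hN]
  have h : ∀ n : ℕ, 0 ≤ t ^ n ∧ t ^ n ≤ 1 := fun n =>
    ⟨by positivity, pow_le_one₀ h0 (by linarith)⟩
  nlinarith only [mul_nonneg (sq_nonneg (t - 0.3023)) hQ, h 1, h 2, h 3, h 4, h 5, h 6, h 7, h 8]

lemma HS3_le_of_ge {μ : ℝ} (hμ : 32 / 25 ≤ μ) : HS3 μ ≤ 1.01399 * (π / 4) := by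
  have hμ0 : 0 < μ := by linarith
  have ha2 : 0 < μ ^ 2 - 1 := by nlinarith
  have h := HS3_le_of_one_lt hμ0 (Real.sqrt_pos.2 ha2) (Real.sq_sqrt ha2.le)
  have ha := Real.sqrt_pos.2 ha2
  have haq := Real.sq_sqrt ha2.le
  set a := √(μ ^ 2 - 1)
  have ht : 1 / μ ≤ 25 / 32 := by rw [div_le_iff₀ hμ0]; linarith
  have hp := one_le_sq_mul_one_sub_sq (by positivity) ht
  have h1 : μ / a ≤ 1.01399 + 1.2732 * (1 / μ) ^ 3 := by
    refine (sq_le_sq₀ (by positivity) (by positivity)).1 ?_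
    have e : 1 - (1 / μ) ^ 2 = (a / μ) ^ 2 := by
      rw [div_pow, div_pow, haq]
      field_simp
    rw [e] at hp
    calc (μ / a) ^ 2 ≤ (μ / a) ^ 2 * ((1.01399 + 1.2732 * (1 / μ) ^ 3) ^ 2 * (a / μ) ^ 2) :=
          le_mul_of_one_le_right (by positivity) hp
      _ = _ := by field_simp
  have h2 : 1.2732 * (π / 4) ≤ 1 := by linarith [Real.pi_lt_d4]
  have h3 : (1 / μ) ^ 3 = 1 / μ ^ 3 := by simp
  rw [h3] at h1
  have h4 : 0 < 1 / μ ^ 3 := by positivity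
  nlinarith [mul_le_mul_of_nonneg_left h1 (show 0 ≤ π / 4 by positivity)]

lemma HS3_le_of_ge_ten {μ : ℝ} (hμ : 10 ≤ μ) : HS3 μ ≤ 1.0139 * (π / 4) := by
  have hμ0 : 0 < μ := by linarith
  have ha2 : 0 < μ ^ 2 - 1 := by nlinarith
  have h := HS3_le_of_one_lt hμ0 (Real.sqrt_pos.2 ha2) (Real.sq_sqrt ha2.le)
  have ha := Real.sqrt_pos.2 ha2
  have haq := Real.sq_sqrt ha2.le
  set a := √(μ ^ 2 - 1)
  have h1 : μ / a ≤ 1.0139 := by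
    rw [div_le_iff₀ ha]
    refine (sq_le_sq₀ hμ0.le (by positivity)).1 ?_
    nlinarith
  have h4 : 0 < 1 / μ ^ 3 := by positivity
  nlinarith [mul_le_mul_of_nonneg_left h1 (show 0 ≤ π / 4 by positivity)]

/-- The point `3.3` is close to `1 / 0.3023`, the approximate maximizer. -/
lemma le_HS3 : 1.0139 * (π / 4) ≤ HS3 3.3 := by
  have ha2 : (0 : ℝ) < 3.3 ^ 2 - 1 := by norm_num
  have h := le_HS3_of_one_lt (by norm_num) (Real.sqrt_pos.2 ha2) (Real.sq_sqrt ha2.le)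
  have ha := Real.sqrt_pos.2 ha2
  have haq := Real.sq_sqrt ha2.le
  set a := √((3.3 : ℝ) ^ 2 - 1)
  have h1 : a ≤ 3.144838 := Real.sqrt_le_iff.2 ⟨by norm_num, by norm_num⟩
  have h2 : 3 ≤ a := Real.le_sqrt' (by norm_num) |>.2 (by norm_num)
  have h3 : (1.049338 : ℝ) ≤ 3.3 / a := by
    rw [le_div_iff₀ ha]
    linarith
  have h5 : (3800 : ℝ) ≤ sinh (π * a) := by
    have h6 : (9 : ℝ) ≤ π * a := by nlinarith [Real.pi_gt_three]
    refine le_trans ?_ (Real.sinh_le_sinh.2 h6)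
    rw [Real.sinh_eq]
    have h7 : rexp (-9) ≤ 1 := by rw [Real.exp_le_one_iff]; norm_num
    have h8 : (2.7 : ℝ) ^ 9 ≤ rexp 9 := by
      rw [show (9 : ℝ) = (9 : ℕ) * 1 by norm_num, Real.exp_nat_mul]
      have := Real.exp_one_gt_d9
      gcongr
      linarith
    norm_num at h8
    linarith
  have h6 : π * 3.3 / sinh (π * a) ^ 2 ≤ 0.000001 := by
    rw [div_le_iff₀ (by positivity)]
    nlinarith [Real.pi_lt_d2]
  have h7 := Real.pi_gt_d4
  refine le_trans ?_ h
  nlinarith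

lemma mul_termS3_le {μ : ℝ} (h0 : 0 ≤ μ) (h1 : μ ≤ 32 / 25) (n : ℕ+) :
    μ * termS3 μ n ≤ 32 / 25 * (1 / ((n : ℝ) + 1) ^ 2) - if n = 1 then 7 / 100 else 0 := by
  have hn : (1 : ℝ) ≤ n := by exact Nat.one_le_cast.2 n.pos
  -- At `n = 1` the left side is `4 μ / (3 + μ ^ 2) ^ 2`, with maximum `1 / 4` at `μ = 1`, and `7 /
  -- 100 = 32 / 25 * 1 / 4 - 1 / 4`.
  split_ifs with h
  · subst h
    rw [termS3]
    norm_num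
    rw [mul_div_assoc', div_le_iff₀ (by positivity)]
    nlinarith [mul_nonneg (sq_nonneg (μ - 1)) (show 0 ≤ μ ^ 2 + 2 * μ + 9 by positivity)]
  · rw [sub_zero, termS3, mul_div_assoc', mul_one_div, div_le_div_iff₀ (by positivity) (by positivity)]
    set k := (n : ℝ) + 1
    have e : (n : ℝ) * (n + 2) = k ^ 2 - 1 := by ring
    have hk : 2 ≤ k := by linarith
    rw [e]
    rcases le_total 1 μ with h2 | h2
    · have : k ^ 2 ≤ k ^ 2 - 1 + μ ^ 2 := by nlinarith
      calc μ * k ^ 2 * k ^ 2 ≤ 32 / 25 * k ^ 2 * k ^ 2 := by gcongr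
        _ = 32 / 25 * (k ^ 2) ^ 2 := by ring
        _ ≤ _ := by gcongr
    · have hs := Real.sq_sqrt h0
      have hs0 := Real.sqrt_nonneg μ
      have hs1 : √μ ≤ 1 := Real.sqrt_le_one.2 h2
      -- With `s = √μ` the difference is `(1 - s) (k ^ 2 - 1 - s - s ^ 2 - s ^ 3)`, nonnegative
      -- since `s ≤ 1` and `k ≥ 2`.
      have : √μ * k ^ 2 ≤ k ^ 2 - 1 + μ ^ 2 := by
        have hs4 : μ ^ 2 = √μ ^ 4 := by rw [show 4 = 2 * 2 from rfl, pow_mul, hs]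
        rw [hs4]
        set s := √μ
        have h3 : s * (1 + s + s ^ 2) ≤ 3 := by nlinarith
        nlinarith [mul_nonneg (sub_nonneg.2 hs1) (show 0 ≤ k ^ 2 - 1 - s * (1 + s + s ^ 2) by nlinarith)]
      calc μ * k ^ 2 * k ^ 2 = 1 * (√μ * k ^ 2) ^ 2 := by rw [mul_pow, hs]; ring
        _ ≤ 32 / 25 * (k ^ 2 - 1 + μ ^ 2) ^ 2 := by gcongr; norm_num

lemma HS3_le_of_le {μ : ℝ} (h0 : 0 ≤ μ) (h1 : μ ≤ 32 / 25) : HS3 μ ≤ π / 4 := by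
  have hs : Summable fun n : ℕ+ => if n = 1 then (7 / 100 : ℝ) else 0 :=
    (hasSum_ite_eq 1 _).summable
  have h := ((summable_termS3 μ).mul_left μ).tsum_le_tsum (mul_termS3_le h0 h1)
    ((summable_one_div_pnat_add_one_sq.mul_left _).sub hs)
  rw [(summable_one_div_pnat_add_one_sq.mul_left _).tsum_sub hs, tsum_mul_left, tsum_mul_left,
    tsum_one_div_pnat_add_one_sq, tsum_ite_eq] at h
  rw [HS3]
  nlinarith [Real.pi_gt_d2, Real.pi_lt_d2]

lemma HS3_le {μ : ℝ} (h0 : 0 ≤ μ) : HS3 μ ≤ 1.01399 * (π / 4) := by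
  rcases le_total μ (32 / 25) with h | h
  · linarith [HS3_le_of_le h0 h, Real.pi_pos]
  · exact HS3_le_of_ge h

lemma exists_HS3_max : ∃ μ₀ : ℝ, 0 ≤ μ₀ ∧ ∀ μ : ℝ, 0 ≤ μ → HS3 μ ≤ HS3 μ₀ := by
  obtain ⟨μ₀, hμ₀, hmax⟩ := isCompact_Icc.exists_isMaxOn (s := Icc (0 : ℝ) 10) ⟨0, by simp⟩
    continuous_HS3.continuousOn
  refine ⟨μ₀, hμ₀.1, fun μ hμ => ?_⟩
  rcases le_total μ 10 with h | h
  · exact hmax ⟨hμ, h⟩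
  · exact (HS3_le_of_ge_ten h).trans (le_HS3.trans (hmax ⟨by norm_num, by norm_num⟩))

theorem proposition4p5 :
    -- the two comparison integrals converge and have the stated values
    (MeasureTheory.IntegrableOn (fun r : ℝ => r ^ 2 / (r ^ 2 + 1) ^ 2) (Set.Ioi 0) ∧
      ∫ r in Set.Ioi (0 : ℝ), r ^ 2 / (r ^ 2 + 1) ^ 2 = Real.pi / 4) ∧
    (MeasureTheory.Integrable (fun x : EuclideanSpace ℝ (Fin 3) => 1 / (‖x‖ ^ 2 + 1) ^ 2) ∧
      ∫ x : EuclideanSpace ℝ (Fin 3), 1 / (‖x‖ ^ 2 + 1) ^ 2 = Real.pi ^ 2) ∧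
    -- both series converge
    (∀ μ : ℝ, 0 ≤ μ → Summable (termS3 μ) ∧ Summable (termT3 μ)) ∧
    -- the sphere: `δ = 1.0139…`, and `δ * π / 4` is the maximum of `H` on `[0, ∞)`
    (∃ δ : ℝ, 1.0139 ≤ δ ∧ δ < 1.0140 ∧
      (∀ μ : ℝ, 0 ≤ μ →
        HS3 μ ≤ δ * ∫ r in Set.Ioi (0 : ℝ), r ^ 2 / (r ^ 2 + 1) ^ 2) ∧
      (∀ μ : ℝ, 0 ≤ μ → HS3 μ ≤ δ * (Real.pi / 4)) ∧
      (∃ μ₀ : ℝ, 0 ≤ μ₀ ∧ HS3 μ₀ = δ * (Real.pi / 4))) ∧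
    -- the torus, with constant `1`
    (∀ μ : ℝ, 0 ≤ μ →
      FT3 μ < ∫ x : EuclideanSpace ℝ (Fin 3), 1 / (‖x‖ ^ 2 + 1) ^ 2) ∧
    (∀ μ : ℝ, 0 ≤ μ → FT3 μ < Real.pi ^ 2) := by
  rw [integral_sq_div_sq, integral_one_div_norm_sq_add_one_sq]
  obtain ⟨μ₀, hμ₀, hmax⟩ := exists_HS3_max
  have hπ : 0 < π / 4 := by positivity
  have hδ : HS3 μ₀ = HS3 μ₀ / (π / 4) * (π / 4) := by field_simp
  refine ⟨⟨integrableOn_sq_div_sq, rfl⟩, ⟨integrable_one_div_norm_sq_add_one_sq, rfl⟩,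
    fun μ _ => ⟨summable_termS3 μ, summable_termT3 μ⟩,
    ⟨HS3 μ₀ / (π / 4), ?_, ?_, ?_, ?_, μ₀, hμ₀, hδ⟩,
    fun μ => FT3_lt_pi_sq, fun μ => FT3_lt_pi_sq⟩
  · rw [le_div_iff₀ hπ]
    exact le_HS3.trans (hmax _ (by norm_num))
  · rw [div_lt_iff₀ hπ]
    linarith [HS3_le hμ₀]
  · exact fun μ hμ => hδ ▸ hmax μ hμ
  · exact fun μ hμ => hδ ▸ hmax μ hμ
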